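/- Let $q$ be a prime power, let $e_1\ge e_2\ge 1$ be integers and put $d=e_1+e_2$. For $i\in\{1,2\}$ let $X_i$ be the set of all $e_i$-dimensional subspaces of $V=\mathbb{F}_q^{d}$, let $Y_i\subseteq X_i$ be non-empty, and put $\alpha_i=|Y_i|/|X_i|$. Write $$\begin{bmatrix} d\\ e_1\end{bmatrix}_q=\prod_{i=0}^{e_1-1}\frac{q^{d-i}-1}{q^{e_1-i}-1},\qquad \omega_q(e)=\prod_{i=1}^{e}(1-q^{-i}),\qquad P=\frac{|\{(S_1,S_2)\in Y_1\times Y_2 : S_1\cap S_2=\{0\}\}|}{|Y_1|\,|Y_2|}.$$ Then $\alpha_1\alpha_2>0$ and $$P\ \ge\ \frac{q^{e_1e_2}}{\begin{bmatrix} d\\ e_1\end{bmatrix}_q}\left(1-\sqrt{\Big(\frac1{\alpha_1}-1\Big)\Big(\frac1{\alpha_2}-1\Big)}\;q^{-d/2}\right).$$ Moreover, for every real $\alpha$ with $\min\{\alpha_1,\alpha_2\}\ge\alpha>0$, $$P\ \ge\ \omega_q(e_2)\left(1-\Big(\frac1\alpha-1\Big)q^{-d/2}\right),$$ and this inequality is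 strict except possibly when $\alpha_1=\alpha_2=\alpha=\dfrac{1}{1+q^{d/2}}$ (in which case the right-hand side is $0$). -/

import Mathlib

namespace SubspaceDensity

/-- The set of all `e`-dimensional subspaces of `V`. -/
def subspacesOfDim (F V : Type*) [Field F] [AddCommGroup V] [Module F V] (e : ℕ) :
    Set (Submodule F V) :=
  {S | Module.finrank F S = e}

/-- The density `|Y| / |X|`, where `X` is the set of all `e`-dimensional subspaces of `V`. -/
noncomputable def density {F V : Type*} [Field F] [AddCommGroup V] [Module F V] (e : ℕ)
    (Y : Set (Submodule F V)) : ℝ :=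
  (Y.ncard : ℝ) / ((subspacesOfDim F V e).ncard : ℝ)

/-- The proportion of pairs in `Y₁ × Y₂` that intersect trivially. -/
noncomputable def trivialProportion {F V : Type*} [Field F] [AddCommGroup V] [Module F V]
    (Y₁ Y₂ : Set (Submodule F V)) : ℝ :=
  ({p : Submodule F V × Submodule F V | p.1 ∈ Y₁ ∧ p.2 ∈ Y₂ ∧ p.1 ⊓ p.2 = ⊥}.ncard : ℝ) /
    ((Y₁.ncard : ℝ) * (Y₂.ncard : ℝ))

/-- The Gaussian binomial coefficient `∏_{i=0}^{b-1} (q^(a-i) - 1) / (q^(b-i) - 1)`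
(used for `b ≤ a` only). -/
noncomputable def gaussBinom (q a b : ℕ) : ℝ :=
  ∏ i ∈ Finset.range b, ((q : ℝ) ^ (a - i) - 1) / ((q : ℝ) ^ (b - i) - 1)

/-- `ω_q(e) = ∏_{i=1}^{e} (1 - q^(-i))`. -/
noncomputable def omega (q e : ℕ) : ℝ :=
  ∏ i ∈ Finset.Icc 1 e, (1 - ((q : ℝ) ^ i)⁻¹)

end SubspaceDensity

open Finset Module
open scoped Classical

set_option linter.unusedSectionVars false

namespace SubspaceDensity

section Counting

variable {F V : Type*} [Field F] [Fintype F] [AddCommGroup V] [Module F V] [Finite V]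

noncomputable instance : Fintype (Submodule F V) := Fintype.ofFinite _

variable (F V) in
/-- The finset of all `k`-dimensional subspaces of `V`. -/
noncomputable def grass (k : ℕ) : Finset (Submodule F V) := {U | finrank F U = k}

@[simp] theorem mem_grass {k : ℕ} {U : Submodule F V} : U ∈ grass F V k ↔ finrank F U = k := by
  simp [grass]

theorem natCard_submodule (S : Submodule F V) :
    Nat.card S = Fintype.card F ^ finrank F S := by
  rw [Module.natCard_eq_pow_finrank (K := F), Nat.card_eq_fintype_card]

/-- The projections onto `S` vanishing on `U` form a torsor under `Hom (V / (S ⊔ U), S)`. -/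
noncomputable def projEquivHom (S U : Submodule F V)
    (p : {f : V →ₗ[F] S // (∀ x : S, f x = x) ∧ U ≤ LinearMap.ker f}) :
    {f : V →ₗ[F] S // (∀ x : S, f x = x) ∧ U ≤ LinearMap.ker f} ≃
      ((V ⧸ (S ⊔ U)) →ₗ[F] S) where
  toFun f := (S ⊔ U).liftQ (f.1 - p.1) (by
    refine sup_le (fun x hx => ?_) (fun x hx => ?_)
    · have h1 := f.2.1 ⟨x, hx⟩
      have h2 := p.2.1 ⟨x, hx⟩
      simp only at h1 h2
      simp [h1, h2]
    · have h1 := f.2.2 hx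
      have h2 := p.2.2 hx
      simp only [LinearMap.mem_ker] at h1 h2
      simp [h1, h2])
  invFun φ := ⟨p.1 + φ ∘ₗ (S ⊔ U).mkQ, fun x => by
      have : (S ⊔ U).mkQ (x : V) = 0 := by
        simpa using Submodule.mem_sup_left x.2
      simp [p.2.1 x, this], fun x hx => by
      have h0 : (S ⊔ U).mkQ x = 0 := by
        simpa using Submodule.mem_sup_right hx
      have h2 := p.2.2 hx
      simp only [LinearMap.mem_ker] at h2
      simp [h2, h0]⟩
  left_inv f := by
    ext x
    simp
  right_inv φ := by
    ext x
    simp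

theorem exists_isCompl_of_disjoint {S U : Submodule F V} (h : Disjoint S U) :
    ∃ T, IsCompl S T ∧ U ≤ T := by
  obtain ⟨T, hT1, hT2⟩ := h.symm.exists_isCompl
  exact ⟨T, hT2.symm, hT1⟩

/-- The number of complements of `S` that contain `U`. -/
theorem card_isCompl_ge {S U : Submodule F V} (h : Disjoint S U) :
    #{T : Submodule F V | IsCompl S T ∧ U ≤ T} =
      Fintype.card F ^ (finrank F S * (finrank F V - finrank F S - finrank F U)) := by
  have e1 : {T : Submodule F V // IsCompl S T ∧ U ≤ T} ≃
      {f : V →ₗ[F] S // (∀ x : S, f x = x) ∧ U ≤ LinearMap.ker f} :=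
    (Equiv.subtypeSubtypeEquivSubtypeInter (fun T => IsCompl S T) (fun T => U ≤ T)).symm.trans
      ((S.isComplEquivProj.subtypeEquiv (fun T => by simp)).trans
        (Equiv.subtypeSubtypeEquivSubtypeInter (fun f : V →ₗ[F] S => ∀ x : S, f x = x)
          (fun f => U ≤ LinearMap.ker f)))
  obtain ⟨T, hT⟩ := exists_isCompl_of_disjoint h
  have e2 := e1.trans (projEquivHom S U (e1 ⟨T, hT⟩))
  have hfr : finrank F (V ⧸ (S ⊔ U)) = finrank F V - finrank F S - finrank F U := by
    have h1 := (S ⊔ U).finrank_quotient_add_finrank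
    have h2 := Submodule.finrank_sup_add_finrank_inf_eq S U
    rw [h.eq_bot, finrank_bot] at h2
    omega
  rw [← Fintype.card_subtype, ← Nat.card_eq_fintype_card, Nat.card_congr e2,
    Module.natCard_eq_pow_finrank (K := F), Nat.card_eq_fintype_card, finrank_linearMap, hfr,
    mul_comm]

/-- The number of `(i+1)`-dimensional subspaces between an `i`-dimensional and an
`m`-dimensional one. -/
theorem card_covers {i m : ℕ} {W T : Submodule F V} (hWT : W ≤ T) (hW : finrank F W = i)
    (hT : finrank F T = m) :
    #{U ∈ grass F V (i + 1) | W ≤ U ∧ U ≤ T} * (Fintype.card F ^ (i + 1) - Fintype.card F ^ i) =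
      Fintype.card F ^ m - Fintype.card F ^ i := by
  have : Fintype V := Fintype.ofFinite V
  have hcard : ∀ {A B : Submodule F V}, A ≤ B →
      #{v : V | v ∈ B ∧ v ∉ A} =
        Fintype.card F ^ finrank F B - Fintype.card F ^ finrank F A := by
    intro A B hAB
    have hs : ({v : V | v ∈ B ∧ v ∉ A} : Finset V) =
        ({v : V | v ∈ B} : Finset V) \ ({v : V | v ∈ A} : Finset V) := by ext; simp
    have hA : ∀ A : Submodule F V, #{v : V | v ∈ A} = Fintype.card F ^ finrank F A := by
      intro A
      rw [← natCard_submodule, ← Fintype.card_subtype, Nat.card_eq_fintype_card]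
    rw [hs, card_sdiff_of_subset, hA, hA]
    intro v hv
    simp only [mem_filter, mem_univ, true_and] at hv ⊢
    exact hAB hv
  have key : ∀ U ∈ ({U ∈ grass F V (i + 1) | W ≤ U ∧ U ≤ T} : Finset _),
      #{v ∈ ({v : V | v ∈ T ∧ v ∉ W} : Finset V) | W ⊔ F ∙ v = U} =
        Fintype.card F ^ (i + 1) - Fintype.card F ^ i := by
    intro U hU
    simp only [mem_filter, mem_grass] at hU
    obtain ⟨hU1, hU2, hU3⟩ := hU
    rw [← hU1, ← hW, ← hcard hU2]
    congr 1
    ext v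
    simp only [mem_filter, mem_univ, true_and]
    constructor
    · rintro ⟨⟨-, hv⟩, rfl⟩
      exact ⟨Submodule.mem_sup_right (Submodule.mem_span_singleton_self v), hv⟩
    · rintro ⟨hv, hvW⟩
      refine ⟨⟨hU3 hv, hvW⟩, ?_⟩
      have hle : W ⊔ F ∙ v ≤ U := sup_le hU2 (by simpa using hv)
      refine Submodule.eq_of_le_of_finrank_le hle ?_
      have hlt : W < W ⊔ F ∙ v := by
        refine lt_of_le_of_ne le_sup_left fun h => hvW ?_
        rw [h]
        exact Submodule.mem_sup_right (Submodule.mem_span_singleton_self v)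
      have := Submodule.finrank_lt_finrank_of_lt hlt
      omega
  rw [← hT, ← hW, ← hcard hWT, hW]
  rw [card_eq_sum_card_fiberwise (f := fun v => W ⊔ F ∙ v)
    (t := {U ∈ grass F V (i + 1) | W ≤ U ∧ U ≤ T}), sum_congr rfl key]
  · simp
  · intro v hv
    simp only [coe_filter, mem_univ, true_and, Set.mem_ofPred_eq, mem_grass] at hv ⊢
    refine ⟨?_, le_sup_left, sup_le hWT (by simpa using hv.1)⟩
    rw [Submodule.finrank_sup_span_singleton hv.2, hW]

/-- The number of complements of `L` in `A`. -/
theorem card_relCompl {L A : Submodule F V} (hLA : L ≤ A) :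
    #{W : Submodule F V | Disjoint L W ∧ L ⊔ W = A} =
      Fintype.card F ^ (finrank F L * (finrank F A - finrank F L)) := by
  have hmap : Submodule.map A.subtype (Submodule.comap A.subtype L) = L := by
    rw [Submodule.map_comap_subtype, inf_eq_right.2 hLA]
  have hfr : finrank F (Submodule.comap A.subtype L) = finrank F L := by
    have := Submodule.finrank_map_subtype_eq A (Submodule.comap A.subtype L)
    rw [hmap] at this
    exact this.symm
  have h := card_isCompl_ge (disjoint_bot_right (a := Submodule.comap A.subtype L))
  rw [finrank_bot, Nat.sub_zero, hfr] at h
  rw [← h]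
  symm
  refine card_nbij (fun T => Submodule.map A.subtype T) ?_ ?_ ?_
  · intro T hT
    simp only [coe_filter, mem_univ, true_and, bot_le, and_true, Set.mem_ofPred_eq] at hT ⊢
    constructor
    · rw [← hmap]
      exact Submodule.disjoint_map A.injective_subtype hT.disjoint
    · conv_lhs => rw [← hmap]
      rw [← Submodule.map_sup, hT.sup_eq_top, Submodule.map_subtype_top]
  · exact (Submodule.map_injective_of_injective A.injective_subtype).injOn
  · intro W hW
    simp only [coe_filter, mem_univ, true_and, bot_le, and_true, Set.mem_ofPred_eq,
      Set.mem_image] at hW ⊢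
    have hWA : W ≤ A := hW.2 ▸ le_sup_right
    have hmapW : Submodule.map A.subtype (Submodule.comap A.subtype W) = W := by
      rw [Submodule.map_comap_subtype, inf_eq_right.2 hWA]
    refine ⟨Submodule.comap A.subtype W, ⟨?_, ?_⟩, hmapW⟩
    · rw [Submodule.disjoint_def]
      intro x hx hx'
      exact Subtype.ext (Submodule.disjoint_def.1 hW.1 x hx hx')
    · rw [codisjoint_iff]
      apply Submodule.map_injective_of_injective A.injective_subtype
      rw [Submodule.map_sup, hmap, hmapW, hW.2, Submodule.map_subtype_top]

/-- The Möbius function of the lattice of subspaces, on an interval of length `k`. -/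
noncomputable def mu (q k : ℕ) : ℝ := (-1) ^ k * (q : ℝ) ^ (k.choose 2)

theorem mu_succ (q k : ℕ) : mu q (k + 1) = -((q : ℝ) ^ k * mu q k) := by
  have : (k + 1).choose 2 = k + k.choose 2 := by
    rw [Nat.choose_succ_succ k 1, Nat.choose_one_right]
  rw [mu, mu, this, pow_add, pow_succ]
  ring

theorem sum_mu (A : Submodule F V) :
    ∑ W : Submodule F V with W ≤ A, mu (Fintype.card F) (finrank F W) =
      if A = ⊥ then 1 else 0 := by
  split_ifs with hA
  · subst hA
    have : ({W : Submodule F V | W ≤ ⊥} : Finset _) = {⊥} := by ext; simp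
    rw [this]
    simp [mu]
  obtain ⟨v, hvA, hv⟩ := A.exists_mem_ne_zero_of_ne_bot hA
  have hL : finrank F (F ∙ v) = 1 := finrank_span_singleton hv
  have hdisj : ∀ W : Submodule F V, Disjoint (F ∙ v) W ↔ ¬ F ∙ v ≤ W := by
    intro W
    rw [disjoint_comm, Submodule.disjoint_span_singleton' hv, Submodule.span_singleton_le_iff_mem]
  have hLA : F ∙ v ≤ A := by simpa using hvA
  generalize F ∙ v = L at hL hdisj hLA
  rw [← sum_fiberwise_of_maps_to (g := fun W => L ⊔ W)
    (t := ({W | L ≤ W ∧ W ≤ A} : Finset (Submodule F V)))]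
  swap
  · intro W hW
    simp only [mem_filter, mem_univ, true_and] at hW ⊢
    exact ⟨le_sup_left, sup_le hLA hW⟩
  refine sum_eq_zero fun B hB => ?_
  simp only [mem_filter, mem_univ, true_and] at hB
  rw [filter_filter, ← sum_filter_add_sum_filter_not _ (fun W => L ≤ W), filter_filter,
    filter_filter]
  have hB1 : ({W | (W ≤ A ∧ L ⊔ W = B) ∧ L ≤ W} : Finset (Submodule F V)) = {B} := by
    ext W
    simp only [mem_filter, mem_univ, true_and, mem_singleton]
    constructor
    · rintro ⟨⟨-, h⟩, h'⟩
      rwa [sup_eq_right.2 h'] at h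
    · rintro rfl
      exact ⟨⟨hB.2, sup_eq_right.2 hB.1⟩, hB.1⟩
  have hB2 : ({W | (W ≤ A ∧ L ⊔ W = B) ∧ ¬ L ≤ W} : Finset (Submodule F V)) =
      ({W | Disjoint L W ∧ L ⊔ W = B} : Finset (Submodule F V)) := by
    ext W
    simp only [mem_filter, mem_univ, true_and, hdisj]
    constructor
    · rintro ⟨⟨-, h⟩, h'⟩
      exact ⟨h', h⟩
    · rintro ⟨h', rfl⟩
      exact ⟨⟨le_sup_right.trans hB.2, rfl⟩, h'⟩
  obtain ⟨k, hk⟩ : ∃ k, finrank F B = k + 1 := by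
    have := Submodule.finrank_mono hB.1
    exact ⟨finrank F B - 1, by omega⟩
  have hB3 : ∀ W ∈ ({W | Disjoint L W ∧ L ⊔ W = B} : Finset (Submodule F V)),
      mu (Fintype.card F) (finrank F W) = mu (Fintype.card F) k := by
    intro W hW
    simp only [mem_filter, mem_univ, true_and] at hW
    have h2 := Submodule.finrank_sup_add_finrank_inf_eq L W
    rw [hW.1.eq_bot, finrank_bot, hW.2] at h2
    congr 1
    omega
  rw [hB1, hB2, sum_singleton, sum_congr rfl hB3, sum_const, card_relCompl hB.1, hL, hk, mu_succ]
  simp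

/-- Counting linearly independent `k`-tuples according to their span. -/
theorem card_grass_mul_prod {k : ℕ} (hk : k ≤ finrank F V) :
    #(grass F V k) * ∏ i ∈ range k, (Fintype.card F ^ k - Fintype.card F ^ i) =
      ∏ i ∈ range k, (Fintype.card F ^ finrank F V - Fintype.card F ^ i) := by
  have : Fintype V := Fintype.ofFinite V
  have h1 := card_linearIndependent (K := F) (V := V) hk
  rw [prod_range, prod_range, ← h1, Nat.card_eq_fintype_card, Fintype.card_subtype]
  rw [card_eq_sum_card_fiberwise (f := fun s => Submodule.span F (Set.range s))
    (t := grass F V k)]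
  · rw [sum_congr rfl (g := fun _ => ∏ i : Fin k, (Fintype.card F ^ k - Fintype.card F ^ i.val))]
    · simp
    intro S hS
    rw [mem_grass] at hS
    have h2 := card_linearIndependent (K := F) (V := S) hS.ge
    rw [hS] at h2
    rw [← h2, Nat.card_eq_fintype_card, Fintype.card_subtype]
    symm
    refine card_nbij (fun s i => (s i : V)) ?_ ?_ ?_
    · intro s hs
      simp only [coe_filter, mem_filter, mem_univ, true_and, Set.mem_ofPred_eq] at hs ⊢
      have hs' : LinearIndependent F (fun i => (s i : V)) :=
        hs.map' S.subtype S.ker_subtype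
      refine ⟨hs', Submodule.eq_of_le_of_finrank_eq ?_ ?_⟩
      · rw [Submodule.span_le]
        rintro _ ⟨i, rfl⟩
        exact (s i).2
      · rw [finrank_span_eq_card hs', Fintype.card_fin, hS]
    · intro s _ t _ hst
      funext i
      exact Subtype.ext (congrFun hst i)
    · intro s hs
      simp only [coe_filter, mem_filter, mem_univ, true_and, Set.mem_ofPred_eq,
        Set.mem_image] at hs ⊢
      have hmem : ∀ i, s i ∈ S := fun i => hs.2 ▸ Submodule.subset_span ⟨i, rfl⟩
      refine ⟨fun i => ⟨s i, hmem i⟩, ?_, rfl⟩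
      exact LinearIndependent.of_comp S.subtype hs.1
  · intro s hs
    simp only [coe_filter, mem_univ, true_and, Set.mem_ofPred_eq, mem_coe, mem_grass] at hs ⊢
    rw [finrank_span_eq_card hs, Fintype.card_fin]

end Counting

theorem sum_orthogonal_mul {ι : Type*} (s : Finset ι) (n : Finset ℕ) (φ : ℕ → ι → ℝ) (c : ℕ → ℝ)
    (horth : ∀ i ∈ n, ∀ j ∈ n, i ≠ j → ∑ T ∈ s, φ i T * φ j T = 0) :
    ∑ T ∈ s, (∑ i ∈ n, φ i T) * (∑ j ∈ n, c j * φ j T) = ∑ j ∈ n, c j * ∑ T ∈ s, φ j T ^ 2 := by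
  simp_rw [sum_mul_sum]
  rw [sum_comm]
  refine sum_congr rfl fun i hi => ?_
  rw [sum_comm, sum_eq_single_of_mem i hi]
  · rw [mul_sum]
    exact sum_congr rfl fun T _ => by ring
  · intro j hj hij
    calc ∑ T ∈ s, φ i T * (c j * φ j T) = c j * ∑ T ∈ s, φ i T * φ j T := by
          rw [mul_sum]
          exact sum_congr rfl fun T _ => by ring
      _ = 0 := by rw [horth i hi j hj hij.symm, mul_zero]

/-- Every vector is the sum of a vector in the range of a matrix and one in the kernel of its
transpose. -/
theorem exists_sub_mulVec_orthogonal {ι κ : Type*} [Fintype ι] [Fintype κ] (A : ι → κ → ℝ)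
    (g : ι → ℝ) : ∃ x : κ → ℝ, ∀ k, ∑ i, A i k * (g i - ∑ l, A i l * x l) = 0 := by
  let K : Submodule ℝ (EuclideanSpace ℝ ι) :=
    Submodule.span ℝ (Set.range fun k => WithLp.toLp 2 fun i => A i k)
  obtain ⟨y, hy, z, hz, hg⟩ := K.exists_add_mem_mem_orthogonal (WithLp.toLp 2 g)
  obtain ⟨x, hx⟩ := (Submodule.mem_span_range_iff_exists_fun ℝ).1 hy
  refine ⟨x, fun k => ?_⟩
  have h1 := (Submodule.mem_orthogonal K z).1 hz _ (Submodule.subset_span ⟨k, rfl⟩)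
  rw [PiLp.inner_apply] at h1
  rw [← h1]
  refine sum_congr rfl fun i _ => ?_
  have h2 : g i = y i + z i := congrArg (fun v : EuclideanSpace ℝ ι => v i) hg
  have h3 : y i = ∑ l, A i l * x l := by
    rw [← hx]
    simp [mul_comm]
  rw [h2, ← h3]
  simp [mul_comm]

section Spectral

variable {F V : Type*} [Field F] [Fintype F] [AddCommGroup V] [Module F V] [Finite V]

/-- The sum of `g` over the `k`-dimensional subspaces contained in `S`. -/
noncomputable def inc (k : ℕ) (g : Submodule F V → ℝ) (S : Submodule F V) : ℝ :=
  ∑ U ∈ grass F V k with U ≤ S, g U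

/-- The sum of `g` over the `k`-dimensional subspaces meeting `S` trivially. -/
noncomputable def opp (k : ℕ) (g : Submodule F V → ℝ) (S : Submodule F V) : ℝ :=
  ∑ U ∈ grass F V k with Disjoint U S, g U

/-- A function on the `k`-dimensional subspaces is harmonic if it sums to zero over those that
contain any given subspace of smaller dimension. -/
def IsHarmonic (k : ℕ) (g : Submodule F V → ℝ) : Prop :=
  ∀ W : Submodule F V, finrank F W < k → ∑ U ∈ grass F V k with W ≤ U, g U = 0

theorem inc_congr {k : ℕ} {f g : Submodule F V → ℝ} (h : ∀ U ∈ grass F V k, f U = g U)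
    (S : Submodule F V) : inc k f S = inc k g S :=
  sum_congr rfl fun U hU => h U (mem_filter.1 hU).1

theorem opp_congr {k : ℕ} {f g : Submodule F V → ℝ} (h : ∀ U ∈ grass F V k, f U = g U)
    (S : Submodule F V) : opp k f S = opp k g S :=
  sum_congr rfl fun U hU => h U (mem_filter.1 hU).1

theorem inc_self {k : ℕ} (f : Submodule F V → ℝ) {S : Submodule F V} (hS : S ∈ grass F V k) :
    inc k f S = f S := by
  have : ({U ∈ grass F V k | U ≤ S} : Finset _) = {S} := by
    ext U
    simp only [mem_filter, mem_grass, mem_singleton] at hS ⊢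
    constructor
    · rintro ⟨h1, h2⟩
      exact Submodule.eq_of_le_of_finrank_eq h2 (by rw [h1, hS])
    · rintro rfl
      exact ⟨hS, le_rfl⟩
  rw [inc, this, sum_singleton]

theorem inc_zero (f : Submodule F V → ℝ) (S : Submodule F V) : inc 0 f S = f ⊥ := by
  have : ({U ∈ grass F V 0 | U ≤ S} : Finset _) = {⊥} := by
    ext U
    simp only [mem_filter, mem_grass, mem_singleton, Submodule.finrank_eq_zero]
    constructor
    · exact fun h => h.1
    · rintro rfl
      exact ⟨rfl, bot_le⟩
  rw [inc, this, sum_singleton]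

theorem inc_add (k : ℕ) (f g : Submodule F V → ℝ) (S : Submodule F V) :
    inc k (fun U => f U + g U) S = inc k f S + inc k g S := sum_add_distrib

theorem inc_mul (k : ℕ) (c : ℝ) (g : Submodule F V → ℝ) (S : Submodule F V) :
    inc k (fun U => c * g U) S = c * inc k g S := (mul_sum ..).symm

theorem opp_mul (k : ℕ) (c : ℝ) (g : Submodule F V → ℝ) (S : Submodule F V) :
    opp k (fun U => c * g U) S = c * opp k g S := (mul_sum ..).symm

theorem opp_sum (k : ℕ) (n : Finset ℕ) (f : ℕ → Submodule F V → ℝ) (S : Submodule F V) :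
    opp k (fun U => ∑ j ∈ n, f j U) S = ∑ j ∈ n, opp k (f j) S := sum_comm

theorem sum_opp_mul (a b : ℕ) (f g : Submodule F V → ℝ) :
    ∑ S ∈ grass F V a, opp b f S * g S = ∑ T ∈ grass F V b, f T * opp a g T := by
  simp_rw [opp, sum_mul, mul_sum]
  exact sum_comm' fun S T => by simp [disjoint_comm]; tauto

theorem exists_card_covers (F V : Type*) [Field F] [Fintype F] [AddCommGroup V] [Module F V]
    [Finite V] (i m : ℕ) : ∃ c : ℝ, (i < m → 0 < c) ∧
    ∀ W T : Submodule F V, W ≤ T → finrank F W = i → finrank F T = m →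
      (#{U ∈ grass F V (i + 1) | W ≤ U ∧ U ≤ T} : ℝ) = c := by
  have hq : 1 < Fintype.card F := Fintype.one_lt_card
  refine ⟨((Fintype.card F ^ m - Fintype.card F ^ i : ℕ) : ℝ) /
    ((Fintype.card F ^ (i + 1) - Fintype.card F ^ i : ℕ) : ℝ), fun him => ?_,
    fun W T hWT hW hT => ?_⟩
  · have h1 := Nat.sub_pos_of_lt (Nat.pow_lt_pow_right hq him)
    have h2 := Nat.sub_pos_of_lt (Nat.pow_lt_pow_right hq (Nat.lt_succ_self i))
    positivity
  · have h2 := Nat.sub_pos_of_lt (Nat.pow_lt_pow_right hq (Nat.lt_succ_self i))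
    rw [eq_div_iff (by positivity)]
    exact_mod_cast card_covers hWT hW hT

theorem isHarmonic_of_pred {k : ℕ} {g : Submodule F V → ℝ}
    (h : ∀ W : Submodule F V, finrank F W + 1 = k → ∑ U ∈ grass F V k with W ≤ U, g U = 0) :
    IsHarmonic k g := by
  suffices H : ∀ n, ∀ W : Submodule F V, finrank F W + (n + 1) = k →
      ∑ U ∈ grass F V k with W ≤ U, g U = 0 from
    fun W hW => H (k - finrank F W - 1) W (by omega)
  intro n
  induction n with
  | zero => exact h
  | succ n ih =>
    intro W hW
    obtain ⟨c, hc, hcard⟩ := exists_card_covers F V (finrank F W) k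
    have hc := hc (by omega)
    have key : ∑ X ∈ grass F V (finrank F W + 1) with W ≤ X, (∑ U ∈ grass F V k with X ≤ U, g U) =
        c * ∑ U ∈ grass F V k with W ≤ U, g U := by
      rw [mul_sum, sum_comm' (t' := {U ∈ grass F V k | W ≤ U})
        (s' := fun U => {X ∈ grass F V (finrank F W + 1) | W ≤ X ∧ X ≤ U})]
      · refine sum_congr rfl fun U hU => ?_
        rw [mem_filter, mem_grass] at hU
        rw [sum_const, nsmul_eq_mul, hcard W U hU.2 rfl hU.1]
      · intro X U
        simp only [mem_filter]
        constructor
        · rintro ⟨⟨h1, h2⟩, h3, h4⟩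
          exact ⟨⟨h1, h2, h4⟩, h3, h2.trans h4⟩
        · rintro ⟨⟨h1, h2, h4⟩, h3, -⟩
          exact ⟨⟨h1, h2⟩, h3, h4⟩
    rw [sum_eq_zero] at key
    · exact (mul_eq_zero.1 key.symm).resolve_left hc.ne'
    · intro X hX
      rw [mem_filter, mem_grass] at hX
      exact ih X (by omega)

theorem IsHarmonic.opp_eq {k : ℕ} {g : Submodule F V → ℝ} (hg : IsHarmonic k g)
    (S : Submodule F V) : opp k g S = mu (Fintype.card F) k * inc k g S := by
  have h1 : opp k g S = ∑ U ∈ grass F V k, ∑ W ∈ ({W | W ≤ U ⊓ S} : Finset (Submodule F V)),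
      mu (Fintype.card F) (finrank F W) * g U := by
    rw [opp, sum_filter]
    refine sum_congr rfl fun U _ => ?_
    rw [← sum_mul, sum_mu, ite_mul, one_mul, zero_mul]
    simp [disjoint_iff]
  rw [h1, sum_comm' (t' := ({W | W ≤ S} : Finset (Submodule F V)))
    (s' := fun W => {U ∈ grass F V k | W ≤ U})]
  swap
  · intro U W
    simp only [mem_filter, mem_univ, true_and, le_inf_iff]
    tauto
  rw [inc, mul_sum]
  have h2 : ({U ∈ grass F V k | U ≤ S} : Finset _) =
      ({W | W ≤ S} : Finset (Submodule F V)).filter (fun W : Submodule F V => finrank F W = k) := by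
    ext U
    simp [and_comm]
  rw [h2]
  conv_rhs => rw [sum_filter]
  refine sum_congr rfl fun W _ => ?_
  rw [← mul_sum]
  split_ifs with hW
  · rw [hW]
    have : ({U ∈ grass F V k | W ≤ U} : Finset _) = {W} := by
      ext U
      simp only [mem_filter, mem_grass, mem_singleton]
      constructor
      · rintro ⟨h1, h2⟩
        exact (Submodule.eq_of_le_of_finrank_eq h2 (by rw [h1, hW])).symm
      · rintro rfl
        exact ⟨hW, le_rfl⟩
    rw [this, sum_singleton]
  · rcases lt_or_gt_of_ne hW with hlt | hgt
    · rw [hg W hlt, mul_zero]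
    · rw [sum_eq_zero, mul_zero]
      intro U hU
      rw [mem_filter, mem_grass] at hU
      have := Submodule.finrank_mono hU.2
      omega

theorem card_opp {a b : ℕ} {S U : Submodule F V} (hV : finrank F V = a + b)
    (hS : finrank F S = a) (hU : Disjoint U S) :
    #{T ∈ grass F V b | Disjoint T S ∧ U ≤ T} = Fintype.card F ^ (a * (b - finrank F U)) := by
  have h := card_isCompl_ge hU.symm
  rw [hV, hS, Nat.add_sub_cancel_left] at h
  rw [← h]
  congr 1
  ext T
  simp only [mem_filter, mem_grass, mem_univ, true_and]
  constructor
  · rintro ⟨h1, h2, h3⟩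
    exact ⟨(Submodule.isCompl_iff_disjoint S T (by omega)).2 h2.symm, h3⟩
  · rintro ⟨h1, h2⟩
    have := Submodule.finrank_add_eq_of_isCompl h1
    exact ⟨by omega, h1.disjoint.symm, h2⟩

theorem opp_inc {a b : ℕ} (j : ℕ) (hV : finrank F V = a + b) (g : Submodule F V → ℝ)
    {S : Submodule F V} (hS : finrank F S = a) :
    opp b (inc j g) S = (Fintype.card F : ℝ) ^ (a * (b - j)) * opp j g S := by
  rw [opp, opp, mul_sum]
  simp_rw [inc]
  rw [sum_comm' (t' := {U ∈ grass F V j | Disjoint U S})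
    (s' := fun U => {T ∈ grass F V b | Disjoint T S ∧ U ≤ T})]
  · refine sum_congr rfl fun U hU => ?_
    rw [mem_filter, mem_grass] at hU
    rw [sum_const, nsmul_eq_mul, card_opp hV hS hU.2, hU.1, Nat.cast_pow]
  · intro T U
    simp only [mem_filter]
    constructor
    · rintro ⟨⟨h1, h2⟩, h3, h4⟩
      exact ⟨⟨h1, h2, h4⟩, h3, h2.mono_left h4⟩
    · rintro ⟨⟨h1, h2, h4⟩, h3, -⟩
      exact ⟨⟨h1, h2⟩, h3, h4⟩

theorem exists_inc_inc (F V : Type*) [Field F] [Fintype F] [AddCommGroup V] [Module F V]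
    [Finite V] (k m : ℕ) : ∃ c : ℝ, ∀ (g : Submodule F V → ℝ), ∀ T ∈ grass F V m,
      inc (k + 1) (inc k g) T = c * inc k g T := by
  obtain ⟨c, -, hc⟩ := exists_card_covers F V k m
  refine ⟨c, fun g T hT => ?_⟩
  rw [mem_grass] at hT
  rw [inc, inc, mul_sum]
  simp_rw [inc]
  rw [sum_comm' (t' := {U ∈ grass F V k | U ≤ T})
    (s' := fun W => {U ∈ grass F V (k + 1) | W ≤ U ∧ U ≤ T})]
  · refine sum_congr rfl fun U hU => ?_
    rw [mem_filter, mem_grass] at hU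
    rw [sum_const, nsmul_eq_mul, hc U T hU.2 hU.1 hT]
  · intro U W
    simp only [mem_filter]
    constructor
    · rintro ⟨⟨h1, h2⟩, h3, h4⟩
      exact ⟨⟨h1, h4, h2⟩, h3, h4.trans h2⟩
    · rintro ⟨⟨h1, h4, h2⟩, h3, -⟩
      exact ⟨⟨h1, h2⟩, h3, h4⟩

theorem exists_isHarmonic_add_inc (k : ℕ) (g : Submodule F V → ℝ) :
    ∃ h g' : Submodule F V → ℝ, IsHarmonic (k + 1) h ∧
      ∀ U ∈ grass F V (k + 1), g U = h U + inc k g' U := by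
  obtain ⟨x, hx⟩ := exists_sub_mulVec_orthogonal
    (fun U W : Submodule F V => if U ∈ grass F V (k + 1) ∧ W ∈ grass F V k ∧ W ≤ U then (1 : ℝ)
      else 0) g
  have hinc : ∀ U ∈ grass F V (k + 1), inc k x U = ∑ W : Submodule F V,
      (if U ∈ grass F V (k + 1) ∧ W ∈ grass F V k ∧ W ≤ U then (1 : ℝ) else 0) * x W := by
    intro U hU
    simp only [ite_mul, one_mul, zero_mul]
    rw [← sum_filter, inc]
    refine sum_congr ?_ fun _ _ => rfl
    ext W
    simp [mem_grass.1 hU]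
  refine ⟨fun U => g U - inc k x U, x, isHarmonic_of_pred fun W hW => ?_, fun U _ => by ring⟩
  have hWk : finrank F W = k := by omega
  rw [← hx W]
  simp only [ite_mul, one_mul, zero_mul]
  rw [← sum_filter]
  refine sum_congr ?_ fun U hU => ?_
  · ext U
    simp [hWk]
  · rw [mem_filter] at hU
    rw [hinc U hU.2.1]
    simp only [ite_mul, one_mul, zero_mul]

theorem exists_inc_eq_sum_harmonic (m k : ℕ) (g : Submodule F V → ℝ) :
    ∃ h : ℕ → Submodule F V → ℝ, (∀ j ∈ range (k + 1), IsHarmonic j (h j)) ∧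
      ∀ T ∈ grass F V m, inc k g T = ∑ j ∈ range (k + 1), inc j (h j) T := by
  induction k generalizing g with
  | zero => exact ⟨fun _ => g, by simp [IsHarmonic], by simp⟩
  | succ k ih =>
    obtain ⟨h, g', hh, hg⟩ := exists_isHarmonic_add_inc k g
    obtain ⟨c, hc⟩ := exists_inc_inc F V k m
    obtain ⟨φ, hφ, hsum⟩ := ih (fun U => c * g' U)
    refine ⟨Function.update φ (k + 1) h, fun j hj => ?_, fun T hT => ?_⟩
    · rcases eq_or_ne j (k + 1) with rfl | hne
      · simpa using hh
      · rw [Function.update_of_ne hne]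
        rw [mem_range] at hj
        exact hφ j (by rw [mem_range]; omega)
    · rw [sum_range_succ, Function.update_self, inc_congr hg, inc_add, hc g' T hT, ← inc_mul,
        hsum T hT, add_comm]
      congr 1
      refine sum_congr rfl fun j hj => ?_
      rw [mem_range] at hj
      rw [Function.update_of_ne (by omega)]

end Spectral

/-- The `j`-th eigenvalue of the composition of the two opposition operators between subspaces of
dimensions `a` and `b`. -/
noncomputable def eigval (q a b j : ℕ) : ℝ :=
  (q : ℝ) ^ (a * (b - j)) * (q : ℝ) ^ (b * (a - j)) * mu q j ^ 2

theorem eigval_pos {q : ℕ} (hq : 1 < q) (a b j : ℕ) : 0 < eigval q a b j := by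
  have : mu q j ≠ 0 := by
    unfold mu
    positivity
  unfold eigval
  positivity

theorem eigval_succ {q a b j : ℕ} (hb : j < b) (ha : j < a) :
    eigval q a b j * (q : ℝ) ^ (2 * j) = (q : ℝ) ^ (a + b) * eigval q a b (j + 1) := by
  obtain ⟨a, rfl⟩ := Nat.exists_eq_add_of_lt ha
  obtain ⟨b, rfl⟩ := Nat.exists_eq_add_of_lt hb
  have h1 : j + a + 1 - j = a + 1 := by omega
  have h2 : j + b + 1 - j = b + 1 := by omega
  have h3 : j + a + 1 - (j + 1) = a := by omega
  have h4 : j + b + 1 - (j + 1) = b := by omega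
  rw [eigval, eigval, h1, h2, h3, h4, mu_succ]
  ring

theorem eigval_lt {q a b i j : ℕ} (hq : 1 < q) (hij : i < j) (hb : j ≤ b) (hab : b ≤ a) :
    eigval q a b j < eigval q a b i := by
  have hstep : ∀ i, i < b → eigval q a b (i + 1) < eigval q a b i := by
    intro i hi
    have h := eigval_succ (q := q) hi (hi.trans_le hab)
    have hq' : (1 : ℝ) < q := by exact_mod_cast hq
    have h1 : (q : ℝ) ^ (2 * i) < (q : ℝ) ^ (a + b) := pow_lt_pow_right₀ hq' (by omega)
    have h2 : (0 : ℝ) < (q : ℝ) ^ (2 * i) := by positivity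
    have h3 := eigval_pos hq a b (i + 1)
    by_contra! hle
    nlinarith
  induction j, hij using Nat.le_induction with
  | base => exact hstep i (by omega)
  | succ j hj ih => exact (hstep j (by omega)).trans (ih (by omega))

section Bound

variable {F V : Type*} [Field F] [Fintype F] [AddCommGroup V] [Module F V] [Finite V]

theorem IsHarmonic.opp_opp_inc {a b j : ℕ} (hV : finrank F V = a + b) {g : Submodule F V → ℝ}
    (hg : IsHarmonic j g) {T : Submodule F V} (hT : T ∈ grass F V b) :
    opp a (opp b (inc j g)) T = eigval (Fintype.card F) a b j * inc j g T := by
  have h1 : ∀ S ∈ grass F V a, opp b (inc j g) S =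
      ((Fintype.card F : ℝ) ^ (a * (b - j)) * mu (Fintype.card F) j) * inc j g S := by
    intro S hS
    rw [opp_inc j hV g (mem_grass.1 hS), hg.opp_eq, mul_assoc]
  rw [opp_congr h1, opp_mul, opp_inc j (hV.trans (add_comm a b)) g (mem_grass.1 hT), hg.opp_eq,
    eigval]
  ring

/-- The operator norm bound for the opposition operator on functions of mean zero. -/
theorem sum_opp_sq_le {a b : ℕ} (hV : finrank F V = a + b) (hab : b ≤ a)
    {f : Submodule F V → ℝ} (hf : ∑ T ∈ grass F V b, f T = 0) :
    ∑ S ∈ grass F V a, opp b f S ^ 2 ≤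
      eigval (Fintype.card F) a b 1 * ∑ T ∈ grass F V b, f T ^ 2 := by
  have hq : 1 < Fintype.card F := Fintype.one_lt_card
  obtain ⟨h, hh, hsum⟩ := exists_inc_eq_sum_harmonic b b f
  have hfsum : ∀ T ∈ grass F V b, f T = ∑ j ∈ range (b + 1), inc j (h j) T := fun T hT => by
    rw [← hsum T hT, inc_self f hT]
  have horth : ∀ i ∈ range (b + 1), ∀ j ∈ range (b + 1), i ≠ j →
      ∑ T ∈ grass F V b, inc i (h i) T * inc j (h j) T = 0 := by
    intro i hi j hj hij
    have h1 : ∑ T ∈ grass F V b, opp a (opp b (inc i (h i))) T * inc j (h j) T =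
        ∑ T ∈ grass F V b, inc i (h i) T * opp a (opp b (inc j (h j))) T := by
      rw [sum_opp_mul b a, sum_opp_mul a b]
    have h2 : ∑ T ∈ grass F V b, opp a (opp b (inc i (h i))) T * inc j (h j) T =
        eigval (Fintype.card F) a b i * ∑ T ∈ grass F V b, inc i (h i) T * inc j (h j) T := by
      rw [mul_sum]
      exact sum_congr rfl fun T hT => by rw [(hh i hi).opp_opp_inc hV hT, mul_assoc]
    have h3 : ∑ T ∈ grass F V b, inc i (h i) T * opp a (opp b (inc j (h j))) T =
        eigval (Fintype.card F) a b j * ∑ T ∈ grass F V b, inc i (h i) T * inc j (h j) T := by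
      rw [mul_sum]
      exact sum_congr rfl fun T hT => by rw [(hh j hj).opp_opp_inc hV hT, mul_left_comm]
    have hne : eigval (Fintype.card F) a b i ≠ eigval (Fintype.card F) a b j := by
      rw [mem_range] at hi hj
      rcases lt_or_gt_of_ne hij with hlt | hgt
      · exact (eigval_lt hq hlt (by omega) hab).ne'
      · exact (eigval_lt hq hgt (by omega) hab).ne
    rw [h2, h3] at h1
    by_contra h0
    exact hne (mul_right_cancel₀ h0 h1)
  have hzero : ∑ T ∈ grass F V b, inc 0 (h 0) T ^ 2 = 0 := by
    have h1 : ∑ T ∈ grass F V b, inc 0 (h 0) T * f T = 0 := by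
      simp_rw [inc_zero]
      rw [← mul_sum, hf, mul_zero]
    have h2 : ∑ T ∈ grass F V b, inc 0 (h 0) T * f T =
        ∑ T ∈ grass F V b, ∑ j ∈ range (b + 1), inc 0 (h 0) T * inc j (h j) T :=
      sum_congr rfl fun T hT => by rw [hfsum T hT, mul_sum]
    rw [← h1, h2, sum_comm (t := range (b + 1)), sum_eq_single_of_mem (s := range (b + 1)) 0 (by simp)]
    · exact sum_congr rfl fun T _ => sq _
    · exact fun j hj hj0 => horth 0 (by simp) j hj hj0.symm
  have hL : ∑ S ∈ grass F V a, opp b f S ^ 2 = ∑ j ∈ range (b + 1),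
      eigval (Fintype.card F) a b j * ∑ T ∈ grass F V b, inc j (h j) T ^ 2 := by
    rw [← sum_orthogonal_mul _ _ _ _ horth]
    simp_rw [sq (opp b f _)]
    rw [sum_opp_mul]
    refine sum_congr rfl fun T hT => ?_
    rw [← hfsum T hT]
    congr 1
    have h1 : ∀ S ∈ grass F V a, opp b f S = ∑ j ∈ range (b + 1), opp b (inc j (h j)) S :=
      fun S _ => by rw [opp_congr hfsum, opp_sum]
    rw [opp_congr h1, opp_sum]
    exact sum_congr rfl fun j hj => (hh j hj).opp_opp_inc hV hT
  have hR : ∑ T ∈ grass F V b, f T ^ 2 =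
      ∑ j ∈ range (b + 1), ∑ T ∈ grass F V b, inc j (h j) T ^ 2 := by
    have := sum_orthogonal_mul (grass F V b) (range (b + 1)) (fun j => inc j (h j)) (fun _ => 1)
      horth
    simp only [one_mul] at this
    rw [← this]
    exact sum_congr rfl fun T hT => by rw [← hfsum T hT, sq]
  rw [hL, hR, mul_sum]
  refine sum_le_sum fun j hj => ?_
  rw [mem_range] at hj
  rcases Nat.eq_zero_or_pos j with rfl | hpos
  · rw [hzero, mul_zero, mul_zero]
  · refine mul_le_mul_of_nonneg_right ?_ (sum_nonneg fun T _ => sq_nonneg _)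
    rcases Nat.eq_or_lt_of_le hpos with rfl | hlt
    · rfl
    · exact (eigval_lt hq hlt (by omega) hab).le

end Bound

section Mixing

variable {F V : Type*} [Field F] [Fintype F] [AddCommGroup V] [Module F V] [Finite V]

theorem opp_const {a b : ℕ} (hV : finrank F V = a + b) (c : ℝ) {S : Submodule F V}
    (hS : S ∈ grass F V a) : opp b (fun _ => c) S = (Fintype.card F : ℝ) ^ (a * b) * c := by
  have h := card_opp hV (mem_grass.1 hS) (disjoint_bot_left (a := S))
  simp only [bot_le, and_true, finrank_bot, Nat.sub_zero] at h
  rw [opp, sum_const, h, nsmul_eq_mul, Nat.cast_pow]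

theorem card_grass_eq {a b : ℕ} (hV : finrank F V = a + b) :
    #(grass F V a) = #(grass F V b) := by
  have h := sum_opp_mul (F := F) (V := V) a b (fun _ => 1) (fun _ => 1)
  rw [sum_congr rfl fun S hS => by rw [opp_const hV 1 hS, mul_one],
    sum_congr (rfl : grass F V b = _) fun S hS => by
      rw [opp_const (hV.trans (add_comm a b)) 1 hS, one_mul], sum_const, sum_const,
    nsmul_eq_mul, nsmul_eq_mul, mul_one, mul_one, mul_comm b a] at h
  have hq : (Fintype.card F : ℝ) ^ (a * b) ≠ 0 := by
    have : Fintype.card F ≠ 0 := Fintype.card_ne_zero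
    positivity
  exact_mod_cast mul_right_cancel₀ hq h

theorem sum_indicator_sub_sq {ι : Type*} {s Y : Finset ι} (hY : Y ⊆ s) (c : ℝ)
    (hc : c * #s = #Y) :
    ∑ i ∈ s, ((if i ∈ Y then (1 : ℝ) else 0) - c) = 0 ∧
    ∑ i ∈ s, ((if i ∈ Y then (1 : ℝ) else 0) - c) ^ 2 = #Y * (1 - c) := by
  have h1 : ∑ i ∈ s, (if i ∈ Y then (1 : ℝ) else 0) = #Y := by
    rw [sum_ite_mem, inter_eq_right.2 hY]
    simp
  constructor
  · rw [sum_sub_distrib, h1, sum_const, nsmul_eq_mul]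
    linarith
  · have h2 : ∀ i ∈ s, ((if i ∈ Y then (1 : ℝ) else 0) - c) ^ 2 =
        (1 - 2 * c) * (if i ∈ Y then (1 : ℝ) else 0) + c ^ 2 := by
      intro i _
      split_ifs <;> ring
    rw [sum_congr rfl h2, sum_add_distrib, ← mul_sum, h1, sum_const, nsmul_eq_mul]
    linear_combination c * hc

/-- The expander mixing lemma for the opposition graph between subspaces of complementary
dimensions. -/
theorem sq_card_disjoint_sub_le {a b : ℕ} (hV : finrank F V = a + b) (hab : b ≤ a)
    {Y₁ Y₂ : Finset (Submodule F V)} (hY₁ : Y₁ ⊆ grass F V a) (hY₂ : Y₂ ⊆ grass F V b)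
    {α₁ α₂ : ℝ} (hα₁ : α₁ * #(grass F V a) = #Y₁) (hα₂ : α₂ * #(grass F V b) = #Y₂) :
    ((#{p ∈ Y₁ ×ˢ Y₂ | p.1 ⊓ p.2 = ⊥} : ℝ) - (Fintype.card F : ℝ) ^ (a * b) * (α₂ * #Y₁)) ^ 2 ≤
      eigval (Fintype.card F) a b 1 * (#Y₂ * (1 - α₂)) * (#Y₁ * (1 - α₁)) := by
  let f : Submodule F V → ℝ := fun T => (if T ∈ Y₂ then (1 : ℝ) else 0) - α₂
  let g : Submodule F V → ℝ := fun S => (if S ∈ Y₁ then (1 : ℝ) else 0) - α₁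
  have hg2 : ∑ S ∈ grass F V a, g S ^ 2 = #Y₁ * (1 - α₁) := (sum_indicator_sub_sq hY₁ α₁ hα₁).2
  have hf : ∑ T ∈ grass F V b, f T = 0 := (sum_indicator_sub_sq hY₂ α₂ hα₂).1
  have hf2 : ∑ T ∈ grass F V b, f T ^ 2 = #Y₂ * (1 - α₂) := (sum_indicator_sub_sq hY₂ α₂ hα₂).2
  have hsum0 : ∑ S ∈ grass F V a, opp b f S = 0 := by
    have h := sum_opp_mul a b f (fun _ => 1)
    simp only [mul_one] at h
    rw [h, sum_congr rfl fun T hT => by rw [opp_const (hV.trans (add_comm a b)) 1 hT],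
      ← sum_mul, hf, zero_mul]
  have hopp : ∀ S ∈ grass F V a, opp b f S =
      #{T ∈ Y₂ | S ⊓ T = ⊥} - (Fintype.card F : ℝ) ^ (a * b) * α₂ := by
    intro S hS
    have h1 := opp_const hV α₂ hS
    have h2 : opp b f S = opp b (fun T => if T ∈ Y₂ then (1 : ℝ) else 0) S -
      opp b (fun _ => α₂) S := sum_sub_distrib ..
    rw [h2, h1, opp, sum_ite_mem]
    congr 1
    rw [sum_const, nsmul_eq_mul, mul_one]
    congr 2
    ext T
    simp only [mem_inter, mem_filter, disjoint_iff, inf_comm T S]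
    constructor
    · exact fun h => ⟨h.2, h.1.2⟩
    · exact fun h => ⟨⟨hY₂ h.1, h.2⟩, h.1⟩
  have hmain : ∑ S ∈ grass F V a, opp b f S * g S =
      (#{p ∈ Y₁ ×ˢ Y₂ | p.1 ⊓ p.2 = ⊥} : ℝ) - (Fintype.card F : ℝ) ^ (a * b) * (α₂ * #Y₁) := by
    have h1 : ∑ S ∈ grass F V a, opp b f S * g S = ∑ S ∈ Y₁, opp b f S := by
      simp only [g, mul_sub, sum_sub_distrib, mul_ite, mul_one, mul_zero]
      rw [← sum_mul, hsum0, zero_mul, sub_zero, sum_ite_mem, inter_eq_right.2 hY₁]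
    rw [h1, sum_congr rfl fun S hS => hopp S (hY₁ hS), sum_sub_distrib, sum_const, nsmul_eq_mul,
      card_filter, sum_product]
    push_cast
    simp_rw [card_filter]
    push_cast
    ring
  calc _ = (∑ S ∈ grass F V a, opp b f S * g S) ^ 2 := by rw [hmain]
    _ ≤ (∑ S ∈ grass F V a, opp b f S ^ 2) * ∑ S ∈ grass F V a, g S ^ 2 :=
      sum_mul_sq_le_sq_mul_sq _ _ _
    _ ≤ eigval (Fintype.card F) a b 1 * (∑ T ∈ grass F V b, f T ^ 2) *
        ∑ S ∈ grass F V a, g S ^ 2 :=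
      mul_le_mul_of_nonneg_right (sum_opp_sq_le hV hab hf) (sum_nonneg fun S _ => sq_nonneg _)
    _ = _ := by rw [hf2, hg2]

theorem card_grass_eq_gaussBinom {k : ℕ} (hk : k ≤ finrank F V) :
    (#(grass F V k) : ℝ) = gaussBinom (Fintype.card F) (finrank F V) k := by
  have hq : 1 < Fintype.card F := Fintype.one_lt_card
  have hq' : (1 : ℝ) < Fintype.card F := by exact_mod_cast hq
  have h := congrArg (Nat.cast : ℕ → ℝ) (card_grass_mul_prod (F := F) (V := V) hk)
  have hcast : ∀ n, k ≤ n → ((∏ i ∈ range k, (Fintype.card F ^ n - Fintype.card F ^ i) : ℕ) : ℝ) =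
      (∏ i ∈ range k, (Fintype.card F : ℝ) ^ i) *
        ∏ i ∈ range k, ((Fintype.card F : ℝ) ^ (n - i) - 1) := by
    intro n hn
    rw [← prod_mul_distrib, Nat.cast_prod]
    refine prod_congr rfl fun i hi => ?_
    rw [mem_range] at hi
    rw [Nat.cast_sub (Nat.pow_le_pow_right hq.le (by omega)), mul_sub, ← pow_add,
      Nat.add_sub_cancel' (by omega)]
    push_cast
    ring
  rw [Nat.cast_mul, hcast k le_rfl, hcast _ hk, mul_left_comm] at h
  have h0 : (∏ i ∈ range k, (Fintype.card F : ℝ) ^ i) ≠ 0 :=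
    prod_ne_zero_iff.2 fun i _ => by positivity
  have h1 : ∏ i ∈ range k, ((Fintype.card F : ℝ) ^ (k - i) - 1) ≠ 0 :=
    prod_ne_zero_iff.2 fun i hi => by
      rw [mem_range] at hi
      exact (sub_pos.2 (one_lt_pow₀ hq' (by omega))).ne'
  rw [gaussBinom, prod_div_distrib, eq_div_iff h1]
  exact mul_left_cancel₀ h0 h

end Mixing

theorem omega_eq_prod_range (q e : ℕ) :
    omega q e = ∏ i ∈ range e, (1 - ((q : ℝ) ^ (e - i))⁻¹) := by
  rw [omega]
  refine prod_nbij' (fun i => e - i) (fun i => e - i) ?_ ?_ ?_ ?_ ?_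
  all_goals
    intro i hi
    simp only [mem_Icc, mem_range] at hi ⊢
    try omega
  rw [Nat.sub_sub_self hi.2]

theorem omega_pos {q : ℕ} (hq : 1 < q) (e : ℕ) : 0 < omega q e := by
  have hq' : (1 : ℝ) < q := by exact_mod_cast hq
  refine prod_pos fun i hi => sub_pos.2 (inv_lt_one_of_one_lt₀ (one_lt_pow₀ hq' ?_))
  rw [mem_Icc] at hi
  omega

theorem omega_mul_gaussBinom_lt {q : ℕ} (hq : 1 < q) (a : ℕ) {b : ℕ} (hb : 1 ≤ b) :
    omega q b * gaussBinom q (a + b) b < (q : ℝ) ^ (a * b) := by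
  have hq' : (1 : ℝ) < q := by exact_mod_cast hq
  rw [omega_eq_prod_range, gaussBinom, ← prod_mul_distrib, pow_mul]
  have h1 : ∏ _i ∈ range b, (q : ℝ) ^ a = ((q : ℝ) ^ a) ^ b := by simp
  rw [← h1]
  have h2 : ∀ i ∈ range b, (1 - ((q : ℝ) ^ (b - i))⁻¹) *
      (((q : ℝ) ^ (a + b - i) - 1) / ((q : ℝ) ^ (b - i) - 1)) =
      (q : ℝ) ^ a - ((q : ℝ) ^ (b - i))⁻¹ ∧ (1 : ℝ) < (q : ℝ) ^ (b - i) := by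
    intro i hi
    rw [mem_range] at hi
    have h3 : (1 : ℝ) < (q : ℝ) ^ (b - i) := one_lt_pow₀ hq' (by omega)
    have h4 : a + b - i = a + (b - i) := by omega
    have h5 := (sub_pos.2 h3).ne'
    refine ⟨?_, h3⟩
    rw [h4, pow_add]
    generalize (q : ℝ) ^ (b - i) = x at *
    have h6 : x ≠ 0 := by positivity
    field_simp
  refine prod_lt_prod_of_nonempty (fun i hi => ?_) (fun i hi => ?_) (by simp; omega)
  · rw [(h2 i hi).1, sub_pos]
    exact (inv_lt_one_of_one_lt₀ (h2 i hi).2).trans_le (one_le_pow₀ hq'.le)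
  · rw [(h2 i hi).1]
    have := (h2 i hi).2
    rw [sub_lt_self_iff]
    positivity

theorem eigval_one {q a b : ℕ} (hq : 1 < q) (ha : 1 ≤ a) (hb : 1 ≤ b) :
    eigval q a b 1 = ((q : ℝ) ^ (a * b) * (q : ℝ) ^ (-(((a + b : ℕ) : ℝ) / 2))) ^ 2 := by
  have hq0 : (0 : ℝ) < q := by exact_mod_cast hq.le
  have h := eigval_succ (q := q) (a := a) (b := b) (j := 0) hb ha
  have h0 : eigval q a b 0 = ((q : ℝ) ^ (a * b)) ^ 2 := by
    simp [eigval, mu, mul_comm b a, sq]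
  have hr : ((q : ℝ) ^ (-(((a + b : ℕ) : ℝ) / 2))) ^ 2 * (q : ℝ) ^ (a + b) = 1 := by
    rw [← Real.rpow_natCast (q : ℝ) (a + b), ← Real.rpow_mul_natCast hq0.le, ← Real.rpow_add hq0]
    norm_num
  rw [h0, mul_zero, pow_zero, mul_one, zero_add] at h
  rw [mul_pow, h]
  linear_combination (-eigval q a b 1) * hr

/-- The passage from the mixing estimate to the bound on proportions. -/
theorem mul_one_sub_sqrt_le {N K r E y₁ y₂ α₁ α₂ : ℝ} (hN : 0 < N) (hK : 0 ≤ K) (hr : 0 ≤ r)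
    (hα₁ : 0 < α₁) (hα₂ : 0 < α₂) (hα₁' : α₁ ≤ 1) (hα₂' : α₂ ≤ 1) (h₁ : y₁ = α₁ * N)
    (h₂ : y₂ = α₂ * N)
    (h : (E - K * (α₂ * y₁)) ^ 2 ≤ (K * r) ^ 2 * (y₂ * (1 - α₂)) * (y₁ * (1 - α₁))) :
    K / N * (1 - Real.sqrt ((1 / α₁ - 1) * (1 / α₂ - 1)) * r) ≤ E / (y₁ * y₂) := by
  have hA₁ : 0 ≤ 1 / α₁ - 1 := sub_nonneg.2 ((one_le_div hα₁).2 hα₁')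
  have hA₂ : 0 ≤ 1 / α₂ - 1 := sub_nonneg.2 ((one_le_div hα₂).2 hα₂')
  have hs := Real.sq_sqrt (mul_nonneg hA₁ hA₂)
  have hs0 := Real.sqrt_nonneg ((1 / α₁ - 1) * (1 / α₂ - 1))
  generalize Real.sqrt ((1 / α₁ - 1) * (1 / α₂ - 1)) = s at hs hs0
  have h3 : (K * r) ^ 2 * (y₂ * (1 - α₂)) * (y₁ * (1 - α₁)) =
      (K * r * s * (α₁ * α₂ * N)) ^ 2 := by
    rw [mul_pow _ (α₁ * α₂ * N), mul_pow _ s, hs, h₁, h₂]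
    field_simp
  rw [h3] at h
  have h4 := (abs_le.1 (abs_le_of_sq_le_sq h (by positivity))).1
  rw [le_div_iff₀ (by rw [h₁, h₂]; positivity)]
  have h5 : K / N * (1 - s * r) * (y₁ * y₂) =
      K * (α₂ * y₁) - K * r * s * (α₁ * α₂ * N) := by
    rw [h₁, h₂]
    field_simp
  rw [h5]
  linarith

/-- The passage from the bound with two densities to the one with a common lower bound. -/
theorem mul_one_sub_le_of_le_min {κ ω r P α₁ α₂ α : ℝ} (hω : 0 < ω) (hωκ : ω < κ) (hr : 0 < r)
    (hP0 : 0 ≤ P) (hα : 0 < α) (hα₁ : α ≤ α₁) (hα₂ : α ≤ α₂) (hα₁' : α₁ ≤ 1) (hα₂' : α₂ ≤ 1)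
    (hP : κ * (1 - Real.sqrt ((1 / α₁ - 1) * (1 / α₂ - 1)) * r) ≤ P) :
    ω * (1 - (1 / α - 1) * r) ≤ P ∧
      (¬ (α₁ = α ∧ α₂ = α ∧ α = 1 / (1 + r⁻¹)) → ω * (1 - (1 / α - 1) * r) < P) := by
  have hA₁ : 0 ≤ 1 / α₁ - 1 := sub_nonneg.2 ((one_le_div (hα.trans_le hα₁)).2 hα₁')
  have hA₂ : 0 ≤ 1 / α₂ - 1 := sub_nonneg.2 ((one_le_div (hα.trans_le hα₂)).2 hα₂')
  have hle₁ : 1 / α₁ - 1 ≤ 1 / α - 1 := sub_le_sub_right (one_div_le_one_div_of_le hα hα₁) 1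
  have hle₂ : 1 / α₂ - 1 ≤ 1 / α - 1 := sub_le_sub_right (one_div_le_one_div_of_le hα hα₂) 1
  have hA : 0 ≤ 1 / α - 1 := hA₁.trans hle₁
  have hs : Real.sqrt ((1 / α₁ - 1) * (1 / α₂ - 1)) ≤ 1 / α - 1 :=
    Real.sqrt_le_iff.2 ⟨hA, by rw [sq]; exact mul_le_mul hle₁ hle₂ hA₂ hA⟩
  have hκ := hω.trans hωκ
  have hP' : κ * (1 - (1 / α - 1) * r) ≤ P := by
    refine le_trans (mul_le_mul_of_nonneg_left ?_ hκ.le) hP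
    exact sub_le_sub_left (mul_le_mul_of_nonneg_right hs hr.le) 1
  rcases lt_trichotomy (1 - (1 / α - 1) * r) 0 with hneg | hzero | hpos
  · have : ω * (1 - (1 / α - 1) * r) < P := (mul_neg_of_pos_of_neg hω hneg).trans_le hP0
    exact ⟨this.le, fun _ => this⟩
  · rw [hzero, mul_zero]
    refine ⟨hP0, fun hne => ?_⟩
    refine lt_of_lt_of_le (mul_pos hκ (sub_pos.2 ?_)) hP
    have hAr : (1 / α - 1) * r = 1 := by linarith
    have hAinv : 1 / α - 1 = r⁻¹ := eq_inv_of_mul_eq_one_left hAr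
    have hApos : 0 < 1 / α - 1 := by rw [hAinv]; positivity
    have hαeq : α = 1 / (1 + r⁻¹) := by rw [← hAinv]; simp
    refine (mul_lt_mul_of_pos_right ((Real.sqrt_lt' hApos).2 ?_) hr).trans_eq hAr
    rw [sq]
    by_cases h₁ : α₁ = α
    · have h₂ : α < α₂ := lt_of_le_of_ne hα₂ fun h => hne ⟨h₁, h.symm, hαeq⟩
      rw [h₁]
      exact mul_lt_mul_of_pos_left (sub_lt_sub_right (one_div_lt_one_div_of_lt hα h₂) 1) hApos
    · have h₂ : α < α₁ := lt_of_le_of_ne hα₁ (Ne.symm h₁)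
      exact (mul_le_mul_of_nonneg_left hle₂ hA₁).trans_lt
        (mul_lt_mul_of_pos_right (sub_lt_sub_right (one_div_lt_one_div_of_lt hα h₂) 1) hApos)
  · have : ω * (1 - (1 / α - 1) * r) < P := (mul_lt_mul_of_pos_right hωκ hpos).trans_le hP'
    exact ⟨this.le, fun _ => this⟩

theorem density_coe {F V : Type*} [Field F] [Fintype F] [AddCommGroup V] [Module F V] [Finite V]
    (e : ℕ) (Y : Finset (Submodule F V)) :
    density e (Y : Set (Submodule F V)) = #Y / #(grass F V e) := by
  have : subspacesOfDim F V e = (grass F V e : Set (Submodule F V)) := by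
    ext U
    simp [subspacesOfDim]
  rw [density, this, Set.ncard_coe_finset, Set.ncard_coe_finset]

theorem trivialProportion_coe {F V : Type*} [Field F] [Fintype F] [AddCommGroup V] [Module F V]
    [Finite V] (Y₁ Y₂ : Finset (Submodule F V)) :
    trivialProportion (Y₁ : Set (Submodule F V)) (Y₂ : Set (Submodule F V)) =
      #{p ∈ Y₁ ×ˢ Y₂ | p.1 ⊓ p.2 = ⊥} / (#Y₁ * #Y₂) := by
  have : {p : Submodule F V × Submodule F V | p.1 ∈ (Y₁ : Set (Submodule F V)) ∧
      p.2 ∈ (Y₂ : Set (Submodule F V)) ∧ p.1 ⊓ p.2 = ⊥} =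
      (({p ∈ Y₁ ×ˢ Y₂ | p.1 ⊓ p.2 = ⊥} : Finset _) : Set _) := by
    ext p
    simp [and_assoc]
  rw [trivialProportion, this, Set.ncard_coe_finset, Set.ncard_coe_finset, Set.ncard_coe_finset]

end SubspaceDensity

open SubspaceDensity

theorem mainTheorem3 (F : Type*) [Field F] [Fintype F] (q : ℕ) (hq : Fintype.card F = q)
    (e₁ e₂ d : ℕ) (he₂ : 1 ≤ e₂) (he : e₂ ≤ e₁) (hd : d = e₁ + e₂)
    (Y₁ Y₂ : Set (Submodule F (Fin d → F)))
    (hY₁ : Y₁ ⊆ SubspaceDensity.subspacesOfDim F (Fin d → F) e₁)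
    (hY₂ : Y₂ ⊆ SubspaceDensity.subspacesOfDim F (Fin d → F) e₂)
    (hne₁ : Y₁.Nonempty) (hne₂ : Y₂.Nonempty)
    (α₁ α₂ : ℝ) (hα₁ : α₁ = SubspaceDensity.density e₁ Y₁)
    (hα₂ : α₂ = SubspaceDensity.density e₂ Y₂) :
    0 < α₁ * α₂ ∧
    (q : ℝ) ^ (e₁ * e₂) / SubspaceDensity.gaussBinom q d e₁ *
        (1 - Real.sqrt ((1 / α₁ - 1) * (1 / α₂ - 1)) * (q : ℝ) ^ (-((d : ℝ) / 2)))
      ≤ SubspaceDensity.trivialProportion Y₁ Y₂ ∧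
    ∀ α : ℝ, 0 < α → α ≤ min α₁ α₂ →
      SubspaceDensity.omega q e₂ * (1 - (1 / α - 1) * (q : ℝ) ^ (-((d : ℝ) / 2)))
        ≤ SubspaceDensity.trivialProportion Y₁ Y₂ ∧
      (¬ (α₁ = α ∧ α₂ = α ∧ α = 1 / (1 + (q : ℝ) ^ ((d : ℝ) / 2))) →
        SubspaceDensity.omega q e₂ * (1 - (1 / α - 1) * (q : ℝ) ^ (-((d : ℝ) / 2)))
          < SubspaceDensity.trivialProportion Y₁ Y₂) := by
  lift Y₁ to Finset (Submodule F (Fin d → F)) using Set.toFinite _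
  lift Y₂ to Finset (Submodule F (Fin d → F)) using Set.toFinite _
  have hq1 : 1 < q := hq ▸ Fintype.one_lt_card
  have hq0 : (0 : ℝ) < q := by exact_mod_cast hq1.le
  have hV : finrank F (Fin d → F) = e₁ + e₂ := by simp [hd]
  have hVd : finrank F (Fin d → F) = d := by simp
  have hsub₁ : Y₁ ⊆ grass F (Fin d → F) e₁ := fun U hU => mem_grass.2 (hY₁ hU)
  have hsub₂ : Y₂ ⊆ grass F (Fin d → F) e₂ := fun U hU => mem_grass.2 (hY₂ hU)
  have hNeq := card_grass_eq hV
  have hN₁ := card_grass_eq_gaussBinom (F := F) (V := Fin d → F) (k := e₁) (by omega)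
  have hN₂ := card_grass_eq_gaussBinom (F := F) (V := Fin d → F) (k := e₂) (by omega)
  rw [hVd, hq] at hN₁
  rw [hV, hq] at hN₂
  have hy₁ : 0 < (#Y₁ : ℝ) := by exact_mod_cast (Finset.coe_nonempty.1 hne₁).card_pos
  have hy₂ : 0 < (#Y₂ : ℝ) := by exact_mod_cast (Finset.coe_nonempty.1 hne₂).card_pos
  have hle₁ : (#Y₁ : ℝ) ≤ #(grass F (Fin d → F) e₁) := by exact_mod_cast card_le_card hsub₁
  have hle₂ : (#Y₂ : ℝ) ≤ #(grass F (Fin d → F) e₂) := by exact_mod_cast card_le_card hsub₂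
  rw [density_coe] at hα₁ hα₂
  rw [trivialProportion_coe]
  have hmix := sq_card_disjoint_sub_le hV he hsub₁ hsub₂ (α₁ := α₁) (α₂ := α₂)
    (by rw [hα₁, div_mul_cancel₀ _ (hy₁.trans_le hle₁).ne'])
    (by rw [hα₂, div_mul_cancel₀ _ (hy₂.trans_le hle₂).ne'])
  rw [← hNeq] at hα₂ hle₂ hN₂
  rw [hq, eigval_one hq1 (he₂.trans he) he₂, ← hd] at hmix
  rw [← hN₁]
  have hlt := omega_mul_gaussBinom_lt hq1 e₁ he₂
  rw [← hN₂] at hlt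
  have hNpos := hy₁.trans_le hle₁
  have hpos₁ : 0 < α₁ := hα₁ ▸ div_pos hy₁ hNpos
  have hpos₂ : 0 < α₂ := hα₂ ▸ div_pos hy₂ hNpos
  have hone₁ : α₁ ≤ 1 := hα₁ ▸ div_le_one_of_le₀ hle₁ hNpos.le
  have hone₂ : α₂ ≤ 1 := hα₂ ▸ div_le_one_of_le₀ hle₂ hNpos.le
  have hr : 0 < (q : ℝ) ^ (-((d : ℝ) / 2)) := Real.rpow_pos_of_pos hq0 _
  have hfirst := mul_one_sub_sqrt_le hNpos (by positivity) hr.le hpos₁ hpos₂ hone₁ hone₂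
    ((eq_div_iff hNpos.ne').1 hα₁).symm ((eq_div_iff hNpos.ne').1 hα₂).symm hmix
  refine ⟨mul_pos hpos₁ hpos₂, hfirst, fun α hα hmin => ?_⟩
  have h := mul_one_sub_le_of_le_min (omega_pos hq1 e₂) ((lt_div_iff₀ hNpos).2 hlt) hr
    (by positivity) hα (hmin.trans (min_le_left _ _)) (hmin.trans (min_le_right _ _)) hone₁ hone₂
    hfirst
  have hinv : ((q : ℝ) ^ (-((d : ℝ) / 2)))⁻¹ = (q : ℝ) ^ ((d : ℝ) / 2) := by
    rw [Real.rpow_neg hq0.le, inv_inv]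
  rwa [hinv] at h
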